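/- **Conventions.** Let $\tau$ be a signature of finitary operation symbols. For a $\tau$-algebra $\mathcal A$ with underlying set $A$, let $\mathrm{Con}(\mathcal A)$ be the complete lattice of congruences of $\mathcal A$, with least element $\Delta_{\mathcal A}$ (equality) and greatest element $\nabla_{\mathcal A}=A^2$; let $\mathcal K(\mathcal A)$ be the set of finitely generated congruences and $\mathcal B(\mathrm{Con}(\mathcal A))$ the set of complemented elements of $\mathrm{Con}(\mathcal A)$. A *maximal congruence* is a maximal element of $\mathrm{Con}(\mathcal A)\setminus\{\nabla_{\mathcal A}\}$, and $\mathrm{Rad}(\mathcal A)$ is the intersection of all maximal congruences. $\mathcal A$ is *non-trivial* if it has at least two elements, *local* if it has exactly one maximal congruence, and *arithmetical* if the lattice $\mathrm{Con}(\mathcal A)$ is distributive and any two congruences of $\mathcal A$ permute. * A congruence $\theta$ of $\mathcal A$ *has CBLP* (the Congruence Boolean Lifting Property) if every complemented element of $\mathrm{Con}(\mathcal A/\theta)$ is of the form $(\alpha\vee\theta)/\theta$ with $\alpha\in\mathcal B(\mathrm{Con}(\mathcal A))$; the algebra $\mathcal A$ *has CBLP* if each of its congruences does. * $\mathcal A$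 *satisfies $(\star)$* if for every $\theta\in\mathcal K(\mathcal A)$ there are $\alpha\in\mathcal K(\mathcal A)$ and $\beta\in\mathcal B(\mathrm{Con}(\mathcal A))$ with $\alpha\subseteq\mathrm{Rad}(\mathcal A)$ and $\theta=\alpha\vee\beta$. * $\mathcal A$ *is maximal* if, for every index set $I$ and all families $(a_i)_{i\in I}$ in $A$ and $(\theta_i)_{i\in I}$ in $\mathrm{Con}(\mathcal A)$: whenever for each finite $J\subseteq I$ there is $x_J\in A$ with $(x_J,a_i)\in\theta_i$ for all $i\in J$, there is $x\in A$ with $(x,a_i)\in\theta_i$ for all $i\in I$. **Proposition.** Let $\mathcal A$ be a non-trivial arithmetical $\tau$-algebra such that $\nabla_{\mathcal A}$ is finitely generated, i.e. $\nabla_{\mathcal A}\in\mathcal K(\mathcal A)$. The following are equivalent: 1. $\mathcal A$ is maximal and satisfies $(\star)$; 2. $\mathcal A$ is maximal and has CBLP; 3. $\mathcal A$ is maximal and $\mathrm{Rad}(\mathcal A)$ has CBLP; 4. $\mathcal A$ is isomorphic to a direct product $\mathcal A_1\times\dots\times\mathcal A_n$, for some $n\ge 1$, of maximal local $\tau$-algebras.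 -/

import Mathlib

/-! # Congruences of universal algebras

A signature is a first-order language `L` without relation symbols (`L.IsAlgebraic`), and an
algebra of that signature is a type `A` with `L.Structure A`. -/

universe u v w

namespace UnivAlg

open FirstOrder FirstOrder.Language FirstOrder.Language.Structure

/-- A congruence of `A`: an equivalence relation compatible with all the operations. -/
structure Congruence (L : FirstOrder.Language.{v, w}) (A : Type u) [L.Structure A] extends Setoid A where
  compat : ∀ {n : ℕ} (f : L.Functions n) (x y : Fin n → A),
    (∀ i, toSetoid.r (x i) (y i)) → toSetoid.r (funMap f x) (funMap f y)

namespace Congruence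

variable {L : FirstOrder.Language.{v, w}} {A : Type u} [L.Structure A]

/-- `θ.Rel a b` means `(a, b) ∈ θ`. -/
def Rel (θ : Congruence L A) (a b : A) : Prop := θ.toSetoid.r a b

theorem rel_ext {θ φ : Congruence L A} (h : ∀ a b, θ.Rel a b ↔ φ.Rel a b) : θ = φ := by
  obtain ⟨s, hs⟩ := θ
  obtain ⟨t, ht⟩ := φ
  obtain rfl : s = t := Setoid.ext h
  rfl

/-- Congruences are ordered by inclusion. -/
instance : PartialOrder (Congruence L A) where
  le θ φ := ∀ a b, θ.Rel a b → φ.Rel a b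
  le_refl _ _ _ h := h
  le_trans _ _ _ h₁ h₂ a b h := h₂ a b (h₁ a b h)
  le_antisymm _ _ h₁ h₂ := rel_ext fun a b => ⟨h₁ a b, h₂ a b⟩

/-- The intersection of a family of congruences. -/
instance : InfSet (Congruence L A) where
  sInf S :=
    { r := fun a b => ∀ θ ∈ S, θ.Rel a b
      iseqv :=
        ⟨fun a θ _ => θ.toSetoid.refl a, fun h θ hθ => θ.toSetoid.symm (h θ hθ),
          fun h₁ h₂ θ hθ => θ.toSetoid.trans (h₁ θ hθ) (h₂ θ hθ)⟩
      compat := fun f x y h θ hθ => θ.compat f x y fun i => h i θ hθ }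

/-- The complete lattice `Con(A)`: meets are intersections, the bottom is equality, the top is the
total relation, and the join is the least congruence that contains both arguments. -/
instance : CompleteLattice (Congruence L A) :=
  { completeLatticeOfInf (Congruence L A) (fun _ =>
      ⟨fun _ hθ _ _ h => h _ hθ, fun _ hφ a b h _ hθ => hφ hθ a b h⟩) with
    inf := fun θ φ =>
      { r := fun a b => θ.Rel a b ∧ φ.Rel a b
        iseqv :=
          ⟨fun a => ⟨θ.toSetoid.refl a, φ.toSetoid.refl a⟩,
            fun h => ⟨θ.toSetoid.symm h.1, φ.toSetoid.symm h.2⟩,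
            fun h₁ h₂ => ⟨θ.toSetoid.trans h₁.1 h₂.1, φ.toSetoid.trans h₁.2 h₂.2⟩⟩
        compat := fun f x y h =>
          ⟨θ.compat f x y fun i => (h i).1, φ.compat f x y fun i => (h i).2⟩ }
    inf_le_left := fun _ _ _ _ h => h.1
    inf_le_right := fun _ _ _ _ h => h.2
    le_inf := fun _ _ _ h₁ h₂ a b h => ⟨h₁ a b h, h₂ a b h⟩
    top :=
      { r := fun _ _ => True
        iseqv := ⟨fun _ => trivial, fun _ => trivial, fun _ _ => trivial⟩
        compat := fun _ _ _ _ => trivial }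
    le_top := fun _ _ _ _ => trivial
    bot :=
      { r := fun a b => a = b
        iseqv := ⟨fun _ => rfl, fun h => h.symm, fun h₁ h₂ => h₁.trans h₂⟩
        compat := fun f _ _ h => congrArg (funMap f) (funext h) }
    bot_le := fun θ a _ h => h ▸ θ.toSetoid.refl a }

/-- The congruence generated by a set of pairs. -/
def Cg (X : Set (A × A)) : Congruence L A :=
  sInf {θ | ∀ p ∈ X, θ.Rel p.1 p.2}

/-- `θ ∈ K(A)`: the congruence `θ` is generated by a finite set of pairs. -/
def IsFinGen (θ : Congruence L A) : Prop :=
  ∃ X : Set (A × A), X.Finite ∧ θ = Cg X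

/-- The underlying set of the quotient algebra `A/θ`. -/
abbrev Quo (θ : Congruence L A) : Type u := Quotient θ.toSetoid

/-- The operations of `A` pass to `A/θ`; `A/θ` then is an algebra through
`FirstOrder.Language.quotientStructure`. -/
instance [L.IsAlgebraic] (θ : Congruence L A) : L.Prestructure θ.toSetoid where
  toStructure := inferInstance
  fun_equiv := fun x y h => θ.compat _ x y h
  rel_equiv := fun {_ r} _ _ _ => isEmptyElim r

/-- For `θ ≤ φ`, the congruence `φ/θ = {(a/θ, b/θ) | (a, b) ∈ φ}` of `A/θ`. -/
def quotientCongruence [L.IsAlgebraic] (θ φ : Congruence L A) (h : θ ≤ φ) :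
    Congruence L θ.Quo where
  r x y := ∃ a b : A, (Quotient.mk θ.toSetoid a = x ∧ Quotient.mk θ.toSetoid b = y) ∧ φ.Rel a b
  iseqv := by
    refine ⟨fun x => ?_, ?_, ?_⟩
    · obtain ⟨a, rfl⟩ := Quotient.exists_rep x
      exact ⟨a, a, ⟨rfl, rfl⟩, φ.toSetoid.refl a⟩
    · rintro x y ⟨a, b, ⟨hx, hy⟩, hab⟩
      exact ⟨b, a, ⟨hy, hx⟩, φ.toSetoid.symm hab⟩
    · rintro x y z ⟨a, b, ⟨hx, hy⟩, hab⟩ ⟨b', c, ⟨hy', hz⟩, hbc⟩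
      have hbb : φ.Rel b b' := h _ _ (Quotient.exact (hy.trans hy'.symm))
      exact ⟨a, c, ⟨hx, hz⟩, φ.toSetoid.trans hab (φ.toSetoid.trans hbb hbc)⟩
  compat := by
    intro n f x y hxy
    choose a b hab hφ using hxy
    refine ⟨funMap f a, funMap f b, ⟨?_, ?_⟩, φ.compat f a b hφ⟩
    · rw [← funMap_quotient_mk' θ.toSetoid f a]
      exact congrArg _ (funext fun i => (hab i).1)
    · rw [← funMap_quotient_mk' θ.toSetoid f b]
      exact congrArg _ (funext fun i => (hab i).2)

/-- The map `u_θ : Con(A) → Con(A/θ)`, `α ↦ (α ∨ θ)/θ`. -/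
def u [L.IsAlgebraic] (θ α : Congruence L A) : Congruence L θ.Quo :=
  quotientCongruence θ (α ⊔ θ) le_sup_right

/-- `θ` has the Congruence Boolean Lifting Property: `u_θ` maps the complemented congruences of `A`
onto the complemented congruences of `A/θ`. -/
def HasCBLP [L.IsAlgebraic] (θ : Congruence L A) : Prop :=
  ∀ γ : Congruence L θ.Quo, IsComplemented γ → ∃ α : Congruence L A, IsComplemented α ∧ u θ α = γ

end Congruence

section Algebras

variable (L : FirstOrder.Language.{v, w}) (A : Type u) [L.Structure A]

/-- `A` is congruence-distributive. -/
def IsCongruenceDistributive : Prop :=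
  ∀ θ φ ψ : Congruence L A, θ ⊓ (φ ⊔ ψ) = (θ ⊓ φ) ⊔ (θ ⊓ ψ)

/-- `A` is congruence-permutable. -/
def IsCongruencePermutable : Prop :=
  ∀ θ φ : Congruence L A, Relation.Comp θ.Rel φ.Rel = Relation.Comp φ.Rel θ.Rel

/-- `A` is arithmetical. -/
def IsArithmetical : Prop :=
  IsCongruenceDistributive L A ∧ IsCongruencePermutable L A

/-- Hypothesis (H): the total congruence of `A` is finitely generated. -/
def HypothesisH : Prop := (⊤ : Congruence L A).IsFinGen

/-- `Rad(A)`: the intersection of the maximal congruences (the coatoms of `Con(A)`). -/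
def Rad : Congruence L A := sInf {μ | IsCoatom μ}

/-- `A` has the Congruence Boolean Lifting Property. -/
def AlgebraHasCBLP [L.IsAlgebraic] : Prop := ∀ θ : Congruence L A, θ.HasCBLP

/-- The property (⋆): every finitely generated congruence is the join of a finitely generated
congruence contained in the radical and of a complemented congruence. -/
def HasStar : Prop :=
  ∀ θ : Congruence L A, θ.IsFinGen →
    ∃ α β : Congruence L A, α.IsFinGen ∧ IsComplemented β ∧ α ≤ Rad L A ∧ θ = α ⊔ β

/-- `A` is local: it has exactly one maximal congruence. -/
def IsLocalAlgebra : Prop := ∃! μ : Congruence L A, IsCoatom μ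

/-- `A` is maximal: every finitely solvable system of congruences `x ≡ a i (mod θ i)` is solvable.
Index sets in the universe of `A` suffice, because a system is determined by the set of its pairs
`(a i, θ i)`. -/
def IsMaximalAlgebra : Prop :=
  ∀ (I : Type u) (a : I → A) (θ : I → Congruence L A),
    (∀ J : Finset I, ∃ x : A, ∀ i ∈ J, (θ i).Rel x (a i)) → ∃ x : A, ∀ i, (θ i).Rel x (a i)

end Algebras

/-- The direct product of a family of algebras, with componentwise operations. -/
instance piStructure {L : FirstOrder.Language.{v, w}} {ι : Type*} (B : ι → Type*) [∀ i, L.Structure (B i)] :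
    L.Structure (∀ i, B i) where
  funMap f x := fun i => funMap f fun k => x k i
  RelMap r x := ∀ i, RelMap r fun k => x k i

end UnivAlg

/-! All conditions pass through a finite local decomposition of `Con(A)`: complemented, pairwise
comaximal congruences π_k with meet ⊥, each lying under exactly one coatom. Such a family is the
kernel family of an isomorphism onto a finite product of local algebras.

From maximality to a decomposition: for a maximal algebra the Chinese remainder theorem extends to
infinitely many coatoms, so each coatom is comaximal with the meet of the others
(`IsMaximalAlgebra.iInf_coatoms_sup_eq_top`), and compactness of ⊤ leaves only finitely many
coatoms. Either (⋆) or CBLP of the radical then gives, for each coatom, a complemented congruence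
below it and below no other coatom; by `IsLocalDecomposition.of_coatoms` these form a decomposition.

From a decomposition back: congruences are compared component by component, a = ⨅ (π_k ⊔ a). In a
local component, two elements with join ⊤ cannot both be proper, so complemented elements lift
(CBLP) and split off (⋆). Maximality of the factors glues by the same formula. -/

/-! ### Local decompositions in a coatomic frame. -/

section Frame

variable {α : Type*} [Order.Frame α] {ι : Type*}

theorem Finite.iInf_sup_eq_of_frame [Finite ι] (f : ι → α) (a : α) :
    (⨅ i, f i) ⊔ a = ⨅ i, f i ⊔ a := by
  cases nonempty_fintype ι
  rw [← Finset.inf_univ_eq_iInf, ← Finset.inf_univ_eq_iInf, Finset.inf_sup_distrib_right]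

theorem Finset.isComplemented_inf (s : Finset ι) (f : ι → α)
    (h : ∀ i ∈ s, IsComplemented (f i)) : IsComplemented (s.inf f) := by
  classical
  induction s using Finset.induction_on with
  | empty => exact isComplemented_top
  | insert i s _ ih =>
    rw [Finset.inf_insert]
    exact (h i (Finset.mem_insert_self _ _)).inf
      (ih fun j hj => h j (Finset.mem_insert_of_mem hj))

theorem Finset.inf_sup_eq_top (s : Finset ι) (f : ι → α) (a : α)
    (h : ∀ i ∈ s, f i ⊔ a = ⊤) : s.inf f ⊔ a = ⊤ := by
  rw [Finset.inf_sup_distrib_right, Finset.inf_eq_top_iff]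
  exact h

/-- A coatom above `b` would contain `a` as well, hence ⊤; so `b = ⊤`. -/
theorem IsCompl.eq_bot_of_le_sInf_coatoms [IsCoatomic α] {a b : α} (h : IsCompl a b)
    (ha : a ≤ sInf {μ | IsCoatom μ}) : a = ⊥ := by
  rcases IsCoatomic.eq_top_or_exists_le_coatom b with rfl | ⟨μ, hμ, hb⟩
  · simpa using h.inf_eq_bot
  · exact absurd (top_le_iff.1 (h.sup_eq_top ▸ sup_le (ha.trans (sInf_le hμ)) hb)) hμ.1

/-- A family of complemented, pairwise comaximal elements with meet `⊥`, above each of which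
there is exactly one coatom. -/
structure IsLocalDecomposition {α : Type*} [CompleteLattice α] {ι : Type*} (π : ι → α) : Prop where
  isComplemented : ∀ k, IsComplemented (π k)
  iInf_eq_bot : ⨅ k, π k = ⊥
  sup_eq_top : ∀ i j, i ≠ j → π i ⊔ π j = ⊤
  existsUnique_coatom : ∀ k, ∃! μ, IsCoatom μ ∧ π k ≤ μ

namespace IsLocalDecomposition

variable {π : ι → α}

theorem eq_iInf_sup [Finite ι] (h : IsLocalDecomposition π) (a : α) : a = ⨅ k, π k ⊔ a := by
  rw [← Finite.iInf_sup_eq_of_frame, h.iInf_eq_bot, bot_sup_eq]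

theorem le_of_forall_le_sup [Finite ι] (h : IsLocalDecomposition π) {a b : α}
    (hab : ∀ k, a ≤ π k ⊔ b) : a ≤ b := by
  rw [h.eq_iInf_sup b]
  exact le_iInf hab

/-- If both joins were proper, they would lie under the unique coatom above `π k`, and so would `a ⊔
b`. -/
theorem sup_eq_top_or [IsCoatomic α] (h : IsLocalDecomposition π) (k : ι) {a b : α}
    (hab : a ⊔ b = ⊤) : π k ⊔ a = ⊤ ∨ π k ⊔ b = ⊤ := by
  by_contra! hn
  obtain ⟨μ, hμ, ha⟩ := (IsCoatomic.eq_top_or_exists_le_coatom (π k ⊔ a)).resolve_left hn.1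
  obtain ⟨ν, hν, hb⟩ := (IsCoatomic.eq_top_or_exists_le_coatom (π k ⊔ b)).resolve_left hn.2
  obtain rfl := (h.existsUnique_coatom k).unique ⟨hμ, le_sup_left.trans ha⟩
    ⟨hν, le_sup_left.trans hb⟩
  exact hμ.1 (top_le_iff.1 (hab ▸ sup_le (le_sup_right.trans ha) (le_sup_right.trans hb)))

/-- The complemented element that is `⊤` in the components of `a` that are `⊤`, and `⊥` in the
others. -/
theorem exists_isComplemented [Finite ι] (h : IsLocalDecomposition π) (a : α) :
    ∃ b, IsComplemented b ∧ ∀ k, (π k ⊔ a = ⊤ → π k ⊔ b = ⊤) ∧ (π k ⊔ a ≠ ⊤ → b ≤ π k) := by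
  classical
  cases nonempty_fintype ι
  -- The meet of the `π j` over the proper components of `a`. Where `a` is ⊤, `π k` is comaximal
  -- with every factor of this meet.
  refine ⟨(Finset.univ.filter fun k => π k ⊔ a ≠ ⊤).inf π,
    Finset.isComplemented_inf _ _ fun k _ => h.isComplemented k, fun k => ⟨fun hk => ?_, fun hk =>
      Finset.inf_le (by simpa using hk)⟩⟩
  rw [sup_comm]
  refine Finset.inf_sup_eq_top _ _ _ fun j hj => h.sup_eq_top _ _ ?_
  rintro rfl
  exact (Finset.mem_filter.1 hj).2 hk

/-- In each component `γ` or `δ` is ⊤. If `γ` is not, then `δ` is, so there `γ` coincides with `γ ⊓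
δ = θ`. Hence `γ` is `θ` enlarged to ⊤ in the components where `γ` is ⊤. -/
theorem exists_isComplemented_sup_eq [Finite ι] [IsCoatomic α] (h : IsLocalDecomposition π)
    {θ γ δ : α} (hinf : γ ⊓ δ = θ) (hsup : γ ⊔ δ = ⊤) : ∃ a, IsComplemented a ∧ a ⊔ θ = γ := by
  obtain ⟨a, ha, hk⟩ := h.exists_isComplemented γ
  have hθ : θ ≤ γ := hinf ▸ inf_le_left
  refine ⟨a, ha, le_antisymm (h.le_of_forall_le_sup fun k => ?_)
    (h.le_of_forall_le_sup fun k => ?_)⟩ <;> by_cases hγ : π k ⊔ γ = ⊤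
  · simp [hγ]
  · exact sup_le (((hk k).2 hγ).trans le_sup_left) (hθ.trans le_sup_right)
  · rw [← sup_assoc, (hk k).1 hγ, top_sup_eq]
    exact le_top
  · have hδ := (h.sup_eq_top_or k hsup).resolve_left hγ
    calc γ ≤ (π k ⊔ γ) ⊓ (π k ⊔ δ) := by rw [hδ, inf_top_eq]; exact le_sup_right
      _ = π k ⊔ θ := by rw [← sup_inf_left, hinf]
      _ ≤ π k ⊔ (a ⊔ θ) := sup_le_sup_left le_sup_right _

theorem exists_le_coatom [Finite ι] (h : IsLocalDecomposition π) {μ : α} (hμ : IsCoatom μ) :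
    ∃ k, π k ≤ μ := by
  by_contra! hn
  refine hμ.1 (top_le_iff.1 (h.le_of_forall_le_sup fun k => ?_))
  rw [sup_comm, hμ.2 _ (left_lt_sup.2 (hn k))]

/-- The lattice form of (⋆), with θ = (θ ⊓ c) ⊔ b. Here `b` collects the components where `θ` is ⊤;
meeting with `c` erases these, and in every other component `θ` is already under the only coatom. -/
theorem exists_star [Finite ι] [IsCoatomic α] (h : IsLocalDecomposition π) (θ : α) :
    ∃ b c, IsCompl b c ∧ b ≤ θ ∧ θ ⊓ c ≤ sInf {μ | IsCoatom μ} := by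
  obtain ⟨b, ⟨c, hbc⟩, hk⟩ := h.exists_isComplemented θ
  refine ⟨b, c, hbc, h.le_of_forall_le_sup fun k => ?_, le_sInf fun μ hμ => ?_⟩
  · by_cases hθ : π k ⊔ θ = ⊤
    · simp [hθ]
    · exact ((hk k).2 hθ).trans le_sup_left
  · obtain ⟨k, hkμ⟩ := h.exists_le_coatom hμ
    by_cases hθ : π k ⊔ θ = ⊤
    · calc θ ⊓ c ≤ c ⊓ (π k ⊔ b) := by rw [(hk k).1 hθ, inf_top_eq]; exact inf_le_right
        _ = c ⊓ π k := by rw [inf_sup_left, hbc.symm.inf_eq_bot, sup_bot_eq]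
        _ ≤ μ := inf_le_right.trans hkμ
    · obtain ⟨ν, hν, hle⟩ := (IsCoatomic.eq_top_or_exists_le_coatom (π k ⊔ θ)).resolve_left hθ
      obtain rfl := (h.existsUnique_coatom k).unique ⟨hμ, hkμ⟩ ⟨hν, le_sup_left.trans hle⟩
      exact inf_le_left.trans (le_sup_right.trans hle)

end IsLocalDecomposition

/-- The meet of the `a μ` is complemented and lies in the radical, so it is ⊥. A coatom above both
`a μ` and `a ν` would equal both `μ` and `ν`. -/
theorem IsLocalDecomposition.of_coatoms [IsCoatomic α] {a : {μ : α // IsCoatom μ} → α}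
    [Finite {μ : α // IsCoatom μ}] (ha : ∀ μ, IsComplemented (a μ)) (hle : ∀ μ, a μ ≤ μ)
    (huniq : ∀ μ ν, a μ ≤ ν.1 → ν = μ) : IsLocalDecomposition a where
  isComplemented := ha
  iInf_eq_bot := by
    cases nonempty_fintype {μ : α // IsCoatom μ}
    obtain ⟨b, hb⟩ := Finset.isComplemented_inf Finset.univ a fun μ _ => ha μ
    rw [Finset.inf_univ_eq_iInf] at hb
    exact hb.eq_bot_of_le_sInf_coatoms (le_sInf fun μ hμ => (iInf_le a ⟨μ, hμ⟩).trans (hle ⟨μ, hμ⟩))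
  sup_eq_top μ ν hne := by
    by_contra hn
    obtain ⟨κ, hκ, h⟩ := (IsCoatomic.eq_top_or_exists_le_coatom _).resolve_left hn
    exact hne ((huniq μ ⟨κ, hκ⟩ (le_sup_left.trans h)).symm.trans
      (huniq ν ⟨κ, hκ⟩ (le_sup_right.trans h)))
  existsUnique_coatom μ :=
    ⟨μ, ⟨μ.2, hle μ⟩, fun ν hν => congrArg Subtype.val (huniq μ ⟨ν, hν.1⟩ hν.2)⟩

/-- A directed set covering `θ ⊓ c` covers `θ` once `b` is joined to its members; meeting with `c`
removes `b` again. -/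
theorem IsCompactElement.inf_of_isCompl {θ b c : α} (hθ : IsCompactElement θ) (h : IsCompl b c) :
    IsCompactElement (θ ⊓ c) := by
  rw [CompleteLattice.isCompactElement_iff_le_of_directed_sSup_le] at hθ ⊢
  intro s hne hs hle
  obtain ⟨x, hx, hxθ⟩ := hθ ((b ⊔ ·) '' s) (hne.image _)
    (by
      rintro _ ⟨x, hx, rfl⟩ _ ⟨y, hy, rfl⟩
      obtain ⟨z, hz, h1, h2⟩ := hs x hx y hy
      exact ⟨_, ⟨z, hz, rfl⟩, sup_le_sup_left h1 _, sup_le_sup_left h2 _⟩)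
    (by
      obtain ⟨x₀, hx₀⟩ := hne
      have h1 : b ≤ sSup ((b ⊔ ·) '' s) := le_sup_left.trans (le_sSup ⟨x₀, hx₀, rfl⟩)
      have h2 : sSup s ≤ sSup ((b ⊔ ·) '' s) :=
        sSup_le fun x hx => le_sup_right.trans (le_sSup ⟨x, hx, rfl⟩)
      calc θ = θ ⊓ b ⊔ θ ⊓ c := by rw [← inf_sup_left, h.sup_eq_top, inf_top_eq]
        _ ≤ _ := sup_le (inf_le_right.trans h1) (hle.trans h2))
  obtain ⟨x, hx, rfl⟩ := hx
  refine ⟨x, hx, ?_⟩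
  calc θ ⊓ c ≤ (b ⊔ x) ⊓ c := inf_le_inf_right _ hxθ
    _ = x ⊓ c := by rw [inf_sup_right, h.inf_eq_bot, bot_sup_eq]
    _ ≤ x := inf_le_left

end Frame

/-! ### Finiteness of the set of coatoms. -/

section CompleteLattice

variable {α : Type*} [CompleteLattice α]

/-- If the top element is compact and every coatom is comaximal with the meet of the others, then
there are only finitely many coatoms. -/
theorem finite_coatoms_of_compact_top (htop : IsCompactElement (⊤ : α))
    (h : ∀ ν : {μ : α // IsCoatom μ}, (⨅ μ : {μ : {μ : α // IsCoatom μ} // μ ≠ ν}, μ.1.1) ⊔ ν.1 = ⊤) :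
    Finite {μ : α // IsCoatom μ} := by
  have := CompleteLattice.coatomic_of_top_compact htop
  -- A coatom `κ` above this supremum would contain both itself and the meet of the other coatoms,
  -- which join to ⊤.
  have hs : (⊤ : α) ≤ ⨆ ν : {μ : α // IsCoatom μ},
      ⨅ μ : {μ : {μ : α // IsCoatom μ} // μ ≠ ν}, μ.1.1 := by
    by_contra hn
    obtain ⟨κ, hκ, hle⟩ := (IsCoatomic.eq_top_or_exists_le_coatom _).resolve_left
      fun he => hn he.ge
    refine hκ.1 (top_le_iff.1 ((h ⟨κ, hκ⟩).ge.trans (sup_le ?_ le_rfl)))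
    exact (le_iSup (fun ν : {μ : α // IsCoatom μ} =>
      ⨅ μ : {μ : {μ : α // IsCoatom μ} // μ ≠ ν}, μ.1.1) ⟨κ, hκ⟩).trans hle
  obtain ⟨s, hs⟩ := CompleteLattice.IsCompactElement.exists_finset_of_le_iSup _ htop _ hs
  refine Set.finite_univ_iff.1 (s.finite_toSet.subset fun μ _ => ?_)
  by_contra hμ
  -- A coatom `μ` outside `s` occurs in each of the meets indexed by `s`, so it lies above their
  -- join ⊤.
  refine μ.2.1 (top_le_iff.1 (hs.trans (iSup₂_le fun ν hν => ?_)))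
  exact iInf_le (fun μ : {μ : {μ : α // IsCoatom μ} // μ ≠ ν} => μ.1.1)
    ⟨μ, fun he => hμ (he ▸ hν)⟩

end CompleteLattice

/-! ### The congruence lattice: compactness, distributivity, permutability. -/

namespace UnivAlg

open FirstOrder FirstOrder.Language FirstOrder.Language.Structure

namespace Congruence

variable {L : FirstOrder.Language.{v, w}} {A B : Type u} [L.Structure A] [L.Structure B]

theorem Rel.refl (θ : Congruence L A) (a : A) : θ.Rel a a := θ.toSetoid.refl a

theorem Rel.symm {θ : Congruence L A} {a b : A} (h : θ.Rel a b) : θ.Rel b a := θ.toSetoid.symm h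

theorem Rel.trans {θ : Congruence L A} {a b c : A} (h : θ.Rel a b) (h' : θ.Rel b c) :
    θ.Rel a c := θ.toSetoid.trans h h'

theorem rel_sInf {S : Set (Congruence L A)} {a b : A} :
    (sInf S).Rel a b ↔ ∀ θ ∈ S, θ.Rel a b := Iff.rfl

theorem rel_iInf {ι : Sort*} {θ : ι → Congruence L A} {a b : A} :
    (⨅ i, θ i).Rel a b ↔ ∀ i, (θ i).Rel a b := by
  simp [iInf, rel_sInf]

theorem rel_finset_inf {ι : Type*} {s : Finset ι} {θ : ι → Congruence L A} {a b : A} :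
    (s.inf θ).Rel a b ↔ ∀ i ∈ s, (θ i).Rel a b := by
  simp [Finset.inf_eq_iInf, rel_iInf]

theorem rel_top (a b : A) : (⊤ : Congruence L A).Rel a b := trivial

theorem rel_bot {a b : A} : (⊥ : Congruence L A).Rel a b ↔ a = b := Iff.rfl

theorem eq_top_iff_rel {θ : Congruence L A} : θ = ⊤ ↔ ∀ a b, θ.Rel a b :=
  ⟨fun h a b => h ▸ rel_top a b, fun h => top_le_iff.1 fun a b _ => h a b⟩

theorem cg_le_iff {X : Set (A × A)} {θ : Congruence L A} :
    Cg X ≤ θ ↔ ∀ p ∈ X, θ.Rel p.1 p.2 :=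
  ⟨fun h p hp => h _ _ (rel_sInf.2 fun _ hφ => hφ p hp), fun h => sInf_le h⟩

theorem cg_mono {X Y : Set (A × A)} (h : X ⊆ Y) : (Cg X : Congruence L A) ≤ Cg Y :=
  cg_le_iff.2 fun p hp => cg_le_iff.1 le_rfl p (h hp)

theorem exists_forall_le_of_directedOn {S : Set (Congruence L A)} (hne : S.Nonempty)
    (hS : DirectedOn (· ≤ ·) S) {ι : Type*} (s : Finset ι) (f : ι → Congruence L A)
    (hf : ∀ i ∈ s, f i ∈ S) : ∃ ψ ∈ S, ∀ i ∈ s, f i ≤ ψ := by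
  classical
  induction s using Finset.induction_on with
  | empty => exact ⟨_, hne.some_mem, by simp⟩
  | insert j s _ ih =>
    obtain ⟨φ, hφ, hle⟩ := ih fun i hi => hf i (Finset.mem_insert_of_mem hi)
    obtain ⟨ψ, hψ, h1, h2⟩ := hS _ (hf j (Finset.mem_insert_self _ _)) φ hφ
    refine ⟨ψ, hψ, fun i hi => ?_⟩
    rcases Finset.mem_insert.1 hi with rfl | hi
    · exact h1
    · exact (hle i hi).trans h2

/-- The union of a directed set of congruences. -/
def directedUnion (S : Set (Congruence L A)) (hne : S.Nonempty) (hS : DirectedOn (· ≤ ·) S) :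
    Congruence L A where
  r a b := ∃ θ ∈ S, θ.Rel a b
  iseqv := by
    refine ⟨fun a => ⟨_, hne.some_mem, Rel.refl _ a⟩, fun ⟨θ, hθ, h⟩ => ⟨θ, hθ, h.symm⟩, ?_⟩
    rintro a b c ⟨θ, hθ, h⟩ ⟨φ, hφ, h'⟩
    obtain ⟨ψ, hψ, h1, h2⟩ := hS θ hθ φ hφ
    exact ⟨ψ, hψ, Rel.trans (h1 _ _ h) (h2 _ _ h')⟩
  compat := by
    intro n f x y h
    choose θ hθ hxy using h
    -- Operations are finitary, so one member of `S` bounds all the congruences involved.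
    obtain ⟨ψ, hψ, hle⟩ : ∃ ψ ∈ S, ∀ i, θ i ≤ ψ := by
      have := exists_forall_le_of_directedOn hne hS Finset.univ θ fun i _ => hθ i
      simpa using this
    exact ⟨ψ, hψ, ψ.compat f x y fun i => hle i _ _ (hxy i)⟩

theorem rel_sSup_of_directedOn {S : Set (Congruence L A)} (hne : S.Nonempty)
    (hS : DirectedOn (· ≤ ·) S) {a b : A} : (sSup S).Rel a b ↔ ∃ θ ∈ S, θ.Rel a b := by
  refine ⟨fun h => ?_, fun ⟨θ, hθ, h⟩ => le_sSup hθ a b h⟩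
  exact (sSup_le fun θ hθ a b h => ⟨θ, hθ, h⟩ : sSup S ≤ directedUnion S hne hS) a b h

theorem IsFinGen.isCompactElement {θ : Congruence L A} (h : θ.IsFinGen) : IsCompactElement θ := by
  obtain ⟨X, hX, rfl⟩ := h
  rw [CompleteLattice.isCompactElement_iff_le_of_directed_sSup_le]
  intro S hne hS hle
  have h := fun p hp => (rel_sSup_of_directedOn hne hS).1 (cg_le_iff.1 hle p hp)
  choose! φ hφ hr using h
  obtain ⟨ψ, hψ, hψ'⟩ := exists_forall_le_of_directedOn hne hS hX.toFinset φ
    fun p hp => hφ p (by simpa using hp)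
  exact ⟨ψ, hψ, cg_le_iff.2 fun p hp => hψ' p (by simpa using hp) _ _ (hr p hp)⟩

theorem eq_sSup_cg (θ : Congruence L A) :
    θ = sSup {φ : Congruence L A | ∃ X : Set (A × A), X.Finite ∧ (∀ p ∈ X, θ.Rel p.1 p.2) ∧ φ = Cg X} := by
  refine le_antisymm (fun a b h => ?_) (sSup_le ?_)
  · have hle : (Cg {(a, b)} : Congruence L A) ≤ _ :=
      le_sSup (s := {φ | ∃ X : Set (A × A), X.Finite ∧ (∀ p ∈ X, θ.Rel p.1 p.2) ∧ φ = Cg X})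
        ⟨_, Set.finite_singleton _, by simpa using h, rfl⟩
    exact hle a b (cg_le_iff.1 le_rfl (a, b) rfl)
  · rintro _ ⟨X, -, hX, rfl⟩
    exact cg_le_iff.2 hX

theorem directedOn_cg (θ : Congruence L A) : DirectedOn (· ≤ ·)
    {φ : Congruence L A | ∃ X : Set (A × A), X.Finite ∧ (∀ p ∈ X, θ.Rel p.1 p.2) ∧ φ = Cg X} := by
  rintro _ ⟨X, hX, hXθ, rfl⟩ _ ⟨Y, hY, hYθ, rfl⟩
  exact ⟨_, ⟨X ∪ Y, hX.union hY, fun p hp => hp.elim (hXθ p) (hYθ p), rfl⟩,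
    cg_mono Set.subset_union_left, cg_mono Set.subset_union_right⟩

theorem isFinGen_iff_isCompactElement {θ : Congruence L A} :
    θ.IsFinGen ↔ IsCompactElement θ := by
  refine ⟨IsFinGen.isCompactElement, fun h => ?_⟩
  rw [CompleteLattice.isCompactElement_iff_le_of_directed_sSup_le] at h
  obtain ⟨_, ⟨X, hX, hXθ, rfl⟩, hle⟩ := h
    {φ : Congruence L A | ∃ X : Set (A × A), X.Finite ∧ (∀ p ∈ X, θ.Rel p.1 p.2) ∧ φ = Cg X}
    ⟨_, ∅, Set.finite_empty, by simp, rfl⟩ (directedOn_cg θ) (eq_sSup_cg θ).le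
  exact ⟨X, hX, le_antisymm hle (cg_le_iff.2 hXθ)⟩

instance : IsCompactlyGenerated (Congruence L A) where
  exists_sSup_eq θ := ⟨_, by
    rintro _ ⟨X, hX, -, rfl⟩
    exact IsFinGen.isCompactElement ⟨X, hX, rfl⟩, (eq_sSup_cg θ).symm⟩

/-- Since (⋆) speaks only of finitely generated congruences, `θ` has to be shrunk to one;
compactness of ⊤ allows it, `θ` being a directed join of such congruences. -/
theorem exists_isFinGen_sup_eq_top (htop : IsCompactElement (⊤ : Congruence L A))
    {θ φ : Congruence L A} (h : φ ⊔ θ = ⊤) : ∃ ψ, ψ.IsFinGen ∧ ψ ≤ θ ∧ φ ⊔ ψ = ⊤ := by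
  rw [CompleteLattice.isCompactElement_iff_le_of_directed_sSup_le] at htop
  set S := {φ : Congruence L A | ∃ X : Set (A × A), X.Finite ∧ (∀ p ∈ X, θ.Rel p.1 p.2) ∧ φ = Cg X}
  have hne : S.Nonempty := ⟨_, ∅, Set.finite_empty, by simp, rfl⟩
  obtain ⟨_, ⟨_, ⟨X, hX, hXθ, rfl⟩, rfl⟩, hle⟩ := htop ((φ ⊔ ·) '' S) (hne.image _)
    (by
      rintro _ ⟨x, hx, rfl⟩ _ ⟨y, hy, rfl⟩
      obtain ⟨z, hz, h1, h2⟩ := directedOn_cg θ x hx y hy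
      exact ⟨_, ⟨z, hz, rfl⟩, sup_le_sup_left h1 _, sup_le_sup_left h2 _⟩)
    (by
      rw [← h]
      refine sup_le (le_sup_left.trans (le_sSup ⟨_, hne.some_mem, rfl⟩)) ?_
      rw [eq_sSup_cg θ]
      exact sSup_le fun x hx => le_sup_right.trans (le_sSup ⟨x, hx, rfl⟩))
  exact ⟨Cg X, ⟨X, hX, rfl⟩, cg_le_iff.2 hXθ, top_le_iff.1 hle⟩

/-- The congruence lattice of a congruence-distributive algebra is a frame. -/
abbrev frameOfDistributive (h : IsCongruenceDistributive L A) : Order.Frame (Congruence L A) :=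
  Order.Frame.ofMinimalAxioms
    { inf_sSup_le_iSup_inf := fun θ S => by
        classical
        -- Compact generation reduces arbitrary joins to finite ones, where binary distributivity
        -- suffices.
        rw [inf_sSup_eq_iSup_inf_sup_finset]
        refine iSup₂_le fun t ht => ?_
        have : ∀ t : Finset (Congruence L A), (∀ φ ∈ t, φ ∈ S) →
            θ ⊓ t.sup id ≤ ⨆ φ ∈ S, θ ⊓ φ := by
          intro t
          induction t using Finset.induction_on with
          | empty => simp
          | insert φ t _ ih =>
            intro ht
            rw [Finset.sup_insert, h]
            exact sup_le (le_iSup₂_of_le φ (ht φ (Finset.mem_insert_self _ _)) le_rfl)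
              (ih fun ψ hψ => ht ψ (Finset.mem_insert_of_mem hψ))
        exact this t fun φ hφ => ht hφ }

/-- By permutability the relational composite of `θ` and `φ` is itself a congruence, and it contains
both. -/
theorem comp_of_rel_sup (hp : IsCongruencePermutable L A) {θ φ : Congruence L A} {a b : A}
    (h : (θ ⊔ φ).Rel a b) : ∃ c, θ.Rel a c ∧ φ.Rel c b := by
  have hp' : ∀ {a b c}, φ.Rel a b → θ.Rel b c → ∃ d, θ.Rel a d ∧ φ.Rel d c := by
    intro a b c h1 h2
    have : Relation.Comp φ.Rel θ.Rel a c := ⟨b, h1, h2⟩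
    rwa [← hp] at this
  let ψ : Congruence L A :=
    { r := fun a b => ∃ c, θ.Rel a c ∧ φ.Rel c b
      iseqv := by
        refine ⟨fun a => ⟨a, Rel.refl _ a, Rel.refl _ a⟩, ?_, ?_⟩
        · rintro a b ⟨c, h1, h2⟩
          exact hp' h2.symm h1.symm
        · rintro a b c ⟨d, h1, h2⟩ ⟨e, h3, h4⟩
          obtain ⟨f, h5, h6⟩ := hp' h2 h3
          exact ⟨f, h1.trans h5, h6.trans h4⟩
      compat := by
        intro n f x y h
        choose c h1 h2 using h
        exact ⟨_, θ.compat f x c h1, φ.compat f c y h2⟩ }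
  exact (sup_le (fun a b h => ⟨b, h, Rel.refl _ b⟩) (fun a b h => ⟨a, Rel.refl _ a, h⟩) :
    θ ⊔ φ ≤ ψ) a b h

/-- The Chinese remainder theorem for pairwise comaximal congruences. -/
theorem exists_rel_of_pairwise_sup_eq_top [Nonempty A] (hA : IsArithmetical L A) {ι : Type*}
    {θ : ι → Congruence L A} (hθ : ∀ i j, i ≠ j → θ i ⊔ θ j = ⊤) (a : ι → A) (s : Finset ι) :
    ∃ x, ∀ i ∈ s, (θ i).Rel x (a i) := by
  classical
  induction s using Finset.induction_on with
  | empty => exact ⟨Classical.arbitrary A, by simp⟩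
  | insert j s hj ih =>
    obtain ⟨x, hx⟩ := ih
    let := frameOfDistributive hA.1
    -- Distributivity makes `θ j` comaximal with the meet of the earlier congruences; permutability
    -- then supplies the element correcting `x`.
    have hs : s.inf θ ⊔ θ j = ⊤ :=
      Finset.inf_sup_eq_top s θ (θ j) fun i hi => hθ i j (by rintro rfl; exact hj hi)
    obtain ⟨c, h1, h2⟩ := comp_of_rel_sup hA.2 (hs ▸ rel_top x (a j))
    refine ⟨c, fun i hi => ?_⟩
    rcases Finset.mem_insert.1 hi with rfl | hi
    · exact h2
    · exact (rel_finset_inf.1 h1 i hi).symm.trans (hx i hi)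

/-! ### Homomorphisms and the correspondence theorem. -/

/-- The preimage of a congruence under a homomorphism. -/
def comap (g : A →[L] B) (θ : Congruence L B) : Congruence L A where
  r a b := θ.Rel (g a) (g b)
  iseqv := ⟨fun a => Rel.refl θ _, fun h => Rel.symm h, fun h h' => Rel.trans h h'⟩
  compat f x y h := by
    rw [g.map_fun, g.map_fun]
    exact θ.compat f _ _ h

/-- The kernel of a homomorphism. -/
abbrev ker (g : A →[L] B) : Congruence L A := comap g ⊥

theorem rel_comap {g : A →[L] B} {θ : Congruence L B} {a b : A} :
    (comap g θ).Rel a b ↔ θ.Rel (g a) (g b) := Iff.rfl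

/-- The image, under a surjective homomorphism, of a congruence that contains the kernel. -/
def map (g : A →[L] B) (hg : Function.Surjective g) (φ : Congruence L A) (h : ker g ≤ φ) :
    Congruence L B where
  r x y := ∃ a b, g a = x ∧ g b = y ∧ φ.Rel a b
  iseqv := by
    refine ⟨fun x => ?_, ?_, ?_⟩
    · obtain ⟨a, rfl⟩ := hg x
      exact ⟨a, a, rfl, rfl, Rel.refl _ a⟩
    · rintro _ _ ⟨a, b, rfl, rfl, hab⟩
      exact ⟨b, a, rfl, rfl, hab.symm⟩
    · rintro _ _ _ ⟨a, b, rfl, rfl, hab⟩ ⟨b', c, hb, rfl, hbc⟩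
      exact ⟨a, c, rfl, rfl, hab.trans (Rel.trans (h _ _ hb.symm) hbc)⟩
  compat := by
    intro n f x y h
    choose a b ha hb hab using h
    obtain rfl : g ∘ a = x := funext ha
    obtain rfl : g ∘ b = y := funext hb
    exact ⟨funMap f a, funMap f b, g.map_fun f a, g.map_fun f b, φ.compat f a b hab⟩

/-- The correspondence theorem. -/
def comapOrderIso (g : A →[L] B) (hg : Function.Surjective g) :
    Congruence L B ≃o Set.Ici (ker g) where
  toFun θ := ⟨comap g θ, fun _ _ h => bot_le (a := θ) _ _ h⟩
  invFun φ := map g hg φ.1 φ.2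
  left_inv θ := by
    refine rel_ext fun x y => ⟨?_, fun h => ?_⟩
    · rintro ⟨a, b, rfl, rfl, h⟩
      exact h
    · obtain ⟨a, rfl⟩ := hg x
      obtain ⟨b, rfl⟩ := hg y
      exact ⟨a, b, rfl, rfl, h⟩
  right_inv φ := by
    refine Subtype.ext (rel_ext fun x y => ⟨?_, fun h => ⟨x, y, rfl, rfl, h⟩⟩)
    rintro ⟨a, b, ha, hb, h⟩
    exact (φ.2 _ _ ha.symm).trans (h.trans (φ.2 _ _ hb))
  map_rel_iff' := by
    intro θ φ
    refine ⟨fun h x y => ?_, fun h a b => h _ _⟩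
    obtain ⟨a, rfl⟩ := hg x
    obtain ⟨b, rfl⟩ := hg y
    exact h a b

theorem exists_comap_eq (g : A →[L] B) (hg : Function.Surjective g) {φ : Congruence L A}
    (h : ker g ≤ φ) : ∃ θ, comap g θ = φ :=
  ⟨(comapOrderIso g hg).symm ⟨φ, h⟩, congrArg Subtype.val ((comapOrderIso g hg).apply_symm_apply _)⟩

theorem ker_le_comap (g : A →[L] B) (θ : Congruence L B) : ker g ≤ comap g θ :=
  fun _ _ h => bot_le (a := θ) _ _ h

theorem comap_le_comap_iff {g : A →[L] B} (hg : Function.Surjective g) {θ φ : Congruence L B} :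
    comap g θ ≤ comap g φ ↔ θ ≤ φ := (comapOrderIso g hg).le_iff_le

theorem comap_injective {g : A →[L] B} (hg : Function.Surjective g) :
    Function.Injective (comap g) := fun _ _ h =>
  le_antisymm ((comap_le_comap_iff hg).1 h.le) ((comap_le_comap_iff hg).1 h.ge)

theorem comap_top (g : A →[L] B) : comap g ⊤ = ⊤ := rfl

theorem comap_inf (g : A →[L] B) (θ φ : Congruence L B) :
    comap g (θ ⊓ φ) = comap g θ ⊓ comap g φ := rfl

theorem comap_sup {g : A →[L] B} (hg : Function.Surjective g) (θ φ : Congruence L B) :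
    comap g (θ ⊔ φ) = comap g θ ⊔ comap g φ := by
  refine le_antisymm ?_ (sup_le ((comap_le_comap_iff hg).2 le_sup_left)
    ((comap_le_comap_iff hg).2 le_sup_right))
  obtain ⟨ψ, hψ⟩ := exists_comap_eq g hg ((ker_le_comap g θ).trans
    (le_sup_left (b := comap g φ)))
  rw [← hψ, comap_le_comap_iff hg]
  exact sup_le ((comap_le_comap_iff hg).1 (hψ ▸ le_sup_left))
    ((comap_le_comap_iff hg).1 (hψ ▸ le_sup_right))

theorem isCoatom_comap_iff {g : A →[L] B} (hg : Function.Surjective g) {θ : Congruence L B} :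
    IsCoatom (comap g θ) ↔ IsCoatom θ := by
  refine ⟨fun h => ⟨fun ht => h.1 (ht ▸ comap_top g), fun φ hφ => ?_⟩,
    fun h => ⟨fun ht => h.1 (comap_injective hg ht), fun φ hφ => ?_⟩⟩
  · exact comap_injective hg (h.2 _ (lt_of_le_of_ne ((comap_le_comap_iff hg).2 hφ.le)
      fun he => hφ.ne (comap_injective hg he)))
  · obtain ⟨φ, rfl⟩ := exists_comap_eq g hg ((ker_le_comap g θ).trans hφ.le)
    rw [h.2 φ (lt_of_le_of_ne ((comap_le_comap_iff hg).1 hφ.le) fun he => hφ.ne (he ▸ rfl)),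
      comap_top]

theorem existsUnique_isCoatom_iff {g : A →[L] B} (hg : Function.Surjective g) :
    (∃! μ : Congruence L B, IsCoatom μ) ↔ ∃! μ : Congruence L A, IsCoatom μ ∧ ker g ≤ μ := by
  constructor
  · rintro ⟨μ, hμ, hu⟩
    refine ⟨comap g μ, ⟨(isCoatom_comap_iff hg).2 hμ, ker_le_comap g μ⟩, ?_⟩
    rintro ν ⟨hν, hle⟩
    obtain ⟨ν, rfl⟩ := exists_comap_eq g hg hle
    rw [hu ν ((isCoatom_comap_iff hg).1 hν)]
  · rintro ⟨μ, ⟨hμ, hle⟩, hu⟩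
    obtain ⟨μ, rfl⟩ := exists_comap_eq g hg hle
    exact ⟨μ, (isCoatom_comap_iff hg).1 hμ, fun ν hν => comap_injective hg
      (hu _ ⟨(isCoatom_comap_iff hg).2 hν, ker_le_comap g ν⟩)⟩

end Congruence

/-- A system in `B` pulls back to `A` by lifting the elements and taking preimages of the
congruences; solutions transfer both ways by surjectivity. -/
theorem IsMaximalAlgebra.of_surjective {L : FirstOrder.Language.{v, w}} {A B : Type u}
    [L.Structure A] [L.Structure B] (h : IsMaximalAlgebra L A) (g : A →[L] B)
    (hg : Function.Surjective g) : IsMaximalAlgebra L B := by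
  intro I b θ hJ
  choose a ha using fun i => hg (b i)
  obtain ⟨x, hx⟩ := h I a (fun i => (θ i).comap g) fun J => by
    obtain ⟨y, hy⟩ := hJ J
    obtain ⟨x, rfl⟩ := hg y
    exact ⟨x, fun i hi => by rw [Congruence.rel_comap, ha]; exact hy i hi⟩
  exact ⟨g x, fun i => by rw [← ha]; exact hx i⟩

/-! ### Quotient algebras and Boolean lifting. -/

namespace Congruence

variable {L : FirstOrder.Language.{v, w}} {A : Type u} [L.Structure A] [L.IsAlgebraic]

/-- The quotient homomorphism `A → A/θ`. -/
def quoHom (θ : Congruence L A) : A →[L] θ.Quo where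
  toFun := Quotient.mk θ.toSetoid
  map_fun' f x := (funMap_quotient_mk' θ.toSetoid f x).symm
  map_rel' r := isEmptyElim r

theorem quoHom_surjective (θ : Congruence L A) : Function.Surjective θ.quoHom := Quotient.exists_rep

theorem quoHom_eq_iff {θ : Congruence L A} {a b : A} : θ.quoHom a = θ.quoHom b ↔ θ.Rel a b :=
  Quotient.eq (r := θ.toSetoid)

theorem ker_quoHom (θ : Congruence L A) : ker θ.quoHom = θ := rel_ext fun _ _ => quoHom_eq_iff

theorem comap_quoHom_u (θ α : Congruence L A) : comap θ.quoHom (u θ α) = α ⊔ θ := by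
  refine rel_ext fun a b => ⟨?_, fun h => ⟨a, b, ⟨rfl, rfl⟩, h⟩⟩
  rintro ⟨a', b', ⟨ha, hb⟩, h⟩
  have ha' : θ.Rel a' a := quoHom_eq_iff.1 ha
  have hb' : θ.Rel b' b := quoHom_eq_iff.1 hb
  exact (le_sup_right (a := α) _ _ ha'.symm).trans (h.trans (le_sup_right (a := α) _ _ hb'))

/-- By the correspondence theorem, complementary pairs in `Con(A/θ)` are pairs in `Con(A)` with meet
`θ` and join ⊤. This form of CBLP no longer mentions quotients. -/
theorem hasCBLP_iff (θ : Congruence L A) : θ.HasCBLP ↔ ∀ γ δ : Congruence L A, γ ⊓ δ = θ →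
    γ ⊔ δ = ⊤ → ∃ α, IsComplemented α ∧ α ⊔ θ = γ := by
  constructor
  · intro h γ δ hinf hsup
    obtain ⟨γ, rfl⟩ := exists_comap_eq θ.quoHom θ.quoHom_surjective (φ := γ) (by
      rw [ker_quoHom, ← hinf]; exact inf_le_left)
    obtain ⟨δ, rfl⟩ := exists_comap_eq θ.quoHom θ.quoHom_surjective (φ := δ) (by
      rw [ker_quoHom, ← hinf]; exact inf_le_right)
    obtain ⟨α, hα, hu⟩ := h γ ⟨δ, IsCompl.of_eq
      (comap_injective θ.quoHom_surjective (by rw [comap_inf, hinf, ← ker, ker_quoHom]))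
      (comap_injective θ.quoHom_surjective (by rw [comap_sup θ.quoHom_surjective, hsup, comap_top]))⟩
    exact ⟨α, hα, by rw [← comap_quoHom_u, hu]⟩
  · rintro h γ ⟨δ, hγδ⟩
    obtain ⟨α, hα, hu⟩ := h (comap θ.quoHom γ) (comap θ.quoHom δ)
      (by rw [← comap_inf, hγδ.inf_eq_bot, ← ker, ker_quoHom])
      (by rw [← comap_sup θ.quoHom_surjective, hγδ.sup_eq_top, comap_top])
    exact ⟨α, hα, comap_injective θ.quoHom_surjective (by rw [comap_quoHom_u, hu])⟩

end Congruence

end UnivAlg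

/-! ### From maximality to a product of local algebras. -/

namespace UnivAlg

open FirstOrder FirstOrder.Language FirstOrder.Language.Structure

open Congruence

variable {L : FirstOrder.Language.{v, w}} {A : Type u} [L.Structure A]

/-- Distinct coatoms are comaximal, so every finite part of the system "b modulo `ν`, a modulo all
other coatoms" is solvable; maximality solves the whole, and the solution links `a` to `b`. -/
theorem IsMaximalAlgebra.iInf_coatoms_sup_eq_top [Nonempty A] (hM : IsMaximalAlgebra L A)
    (hA : IsArithmetical L A) (ν : {μ : Congruence L A // IsCoatom μ}) :
    (⨅ μ : {μ : {μ : Congruence L A // IsCoatom μ} // μ ≠ ν}, μ.1.1) ⊔ ν.1 = ⊤ := by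
  classical
  refine eq_top_iff_rel.2 fun a b => ?_
  obtain ⟨c, hc⟩ := hM {μ : Congruence L A // IsCoatom μ} (fun μ => if μ = ν then b else a)
    Subtype.val (exists_rel_of_pairwise_sup_eq_top hA (fun μ κ hne =>
      μ.2.sup_eq_top_of_ne κ.2 fun h => hne (Subtype.ext h)) _)
  have h1 : (⨅ μ : {μ : {μ : Congruence L A // IsCoatom μ} // μ ≠ ν}, μ.1.1).Rel a c :=
    rel_iInf.2 fun μ => by
      have := hc μ.1
      rw [if_neg μ.2] at this
      exact this.symm
  have h2 : ν.1.Rel c b := by simpa using hc ν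
  exact Rel.trans (le_sup_left (b := ν.1) _ _ h1)
    (le_sup_right (a := ⨅ μ : {μ : {μ : Congruence L A // IsCoatom μ} // μ ≠ ν}, μ.1.1) _ _ h2)

theorem IsMaximalAlgebra.finite_coatoms [Nonempty A] (hM : IsMaximalAlgebra L A)
    (hA : IsArithmetical L A) (hH : HypothesisH L A) :
    Finite {μ : Congruence L A // IsCoatom μ} :=
  finite_coatoms_of_compact_top hH.isCompactElement (hM.iInf_coatoms_sup_eq_top hA)

theorem HypothesisH.isCoatomic (hH : HypothesisH L A) : IsCoatomic (Congruence L A) :=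
  CompleteLattice.coatomic_of_top_compact hH.isCompactElement

theorem exists_isLocalDecomposition_of_hasCBLP [Nonempty A] [L.IsAlgebraic]
    (hM : IsMaximalAlgebra L A) (hA : IsArithmetical L A) (hH : HypothesisH L A)
    (h : (Rad L A).HasCBLP) :
    ∃ α : {μ : Congruence L A // IsCoatom μ} → Congruence L A, IsLocalDecomposition α := by
  have := hH.isCoatomic
  have := hM.finite_coatoms hA hH
  let := frameOfDistributive hA.1
  -- The coatom `μ` and the meet of the others have meet `Rad L A` and join ⊤, so `μ` represents a
  -- complemented element modulo the radical and lifts.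
  have key : ∀ μ : {μ : Congruence L A // IsCoatom μ}, ∃ α, IsComplemented α ∧
      α ⊔ Rad L A = μ.1 := fun μ =>
    (hasCBLP_iff _).1 h μ.1 (⨅ κ : {κ : {μ : Congruence L A // IsCoatom μ} // κ ≠ μ}, κ.1.1)
      (by
        refine le_antisymm (le_sInf fun κ hκ => ?_) (le_inf (sInf_le μ.2) (le_iInf fun κ =>
          sInf_le κ.1.2))
        by_cases he : κ = μ.1
        · exact he ▸ inf_le_left
        · exact inf_le_right.trans (iInf_le (fun κ : {κ : {μ : Congruence L A // IsCoatom μ} //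
            κ ≠ μ} => κ.1.1) ⟨⟨κ, hκ⟩, fun h => he (congrArg Subtype.val h)⟩))
      (by rw [sup_comm]; exact hM.iInf_coatoms_sup_eq_top hA μ)
  choose α hα hμ using key
  refine ⟨α, .of_coatoms hα (fun μ => hμ μ ▸ le_sup_left) fun μ ν hle => Subtype.ext ?_⟩
  -- Every coatom contains the radical, so one above `α μ` also contains `α μ ⊔ Rad L A = μ`.
  have hle' : μ.1 ≤ ν.1 := hμ μ ▸ sup_le hle (sInf_le ν.2)
  exact ((μ.2.le_iff.1 hle').resolve_left ν.2.1)

theorem exists_isLocalDecomposition_of_hasStar [Nonempty A]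
    (hM : IsMaximalAlgebra L A) (hA : IsArithmetical L A) (hH : HypothesisH L A)
    (h : HasStar L A) :
    ∃ α : {μ : Congruence L A // IsCoatom μ} → Congruence L A, IsLocalDecomposition α := by
  have := hH.isCoatomic
  have := hM.finite_coatoms hA hH
  let := frameOfDistributive hA.1
  have key : ∀ μ : {μ : Congruence L A // IsCoatom μ}, ∃ β, IsComplemented β ∧ β ≤ μ.1 ∧
      ∀ ν : {μ : Congruence L A // IsCoatom μ}, β ≤ ν.1 → ν = μ := by
    intro μ
    obtain ⟨θ, hθ, hle, htop⟩ :=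
      exists_isFinGen_sup_eq_top hH.isCompactElement (hM.iInf_coatoms_sup_eq_top hA μ)
    obtain ⟨α, β, -, hβ, hα, rfl⟩ := h θ hθ
    refine ⟨β, hβ, le_sup_right.trans hle, fun ν hν => ?_⟩
    by_contra hne
    -- The part `α` lies in the radical, hence in `ν`. If `β ≤ ν` too, with `ν ≠ μ`, then `ν`
    -- contains both comaximal congruences.
    refine ν.2.1 (top_le_iff.1 (htop ▸ sup_le ?_ (sup_le (hα.trans (sInf_le ν.2)) hν)))
    exact iInf_le (fun κ : {κ : {μ : Congruence L A // IsCoatom μ} // κ ≠ μ} => κ.1.1) ⟨ν, hne⟩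
  choose β hβ hle hu using key
  exact ⟨β, .of_coatoms hβ hle hu⟩

/-- A finite family of pairwise comaximal congruences that meet in `⊥` induces an
isomorphism onto the product of the quotients. -/
theorem nonempty_equiv_pi_quo [Nonempty A] [L.IsAlgebraic] (hA : IsArithmetical L A)
    {ι : Type*} [Finite ι] {α : ι → Congruence L A} (hbot : ⨅ i, α i = ⊥)
    (htop : ∀ i j, i ≠ j → α i ⊔ α j = ⊤) : Nonempty (L.Equiv A (∀ i, (α i).Quo)) := by
  cases nonempty_fintype ι
  let g : A → ∀ i, (α i).Quo := fun a i => (α i).quoHom a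
  have hg : Function.Bijective g := by
    constructor
    · intro a b h
      rw [← rel_bot (L := L), ← hbot, rel_iInf]
      exact fun i => quoHom_eq_iff.1 (congrFun h i)
    · intro x
      choose a ha using fun i => (α i).quoHom_surjective (x i)
      obtain ⟨y, hy⟩ := exists_rel_of_pairwise_sup_eq_top hA htop a Finset.univ
      exact ⟨y, funext fun i => (quoHom_eq_iff.2 (hy i (Finset.mem_univ i))).trans (ha i)⟩
  exact ⟨{ toEquiv := Equiv.ofBijective g hg
           map_fun' := fun f x => funext fun i => (α i).quoHom.map_fun f x
           map_rel' := fun r => isEmptyElim r }⟩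

theorem IsLocalDecomposition.exists_equiv_pi [Nontrivial A] [L.IsAlgebraic]
    (hM : IsMaximalAlgebra L A) (hA : IsArithmetical L A) {ι : Type*} [Finite ι]
    {α : ι → Congruence L A} (h : IsLocalDecomposition α) :
    ∃ (n : ℕ) (_ : 1 ≤ n) (B : Fin n → Type u) (_ : ∀ i, L.Structure (B i)),
      (∀ i, IsMaximalAlgebra L (B i) ∧ IsLocalAlgebra L (B i)) ∧
        Nonempty (L.Equiv A (∀ i, B i)) := by
  -- An empty family has meet ⊤, so ⊤ = ⊥, against non-triviality; this yields `1 ≤ n`.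
  have hι : Nonempty ι := by
    by_contra hn
    rw [not_nonempty_iff] at hn
    obtain ⟨a, b, hab⟩ := exists_pair_ne A
    have hbot := h.iInf_eq_bot
    rw [iInf_of_empty] at hbot
    exact hab (rel_bot.1 (hbot ▸ rel_top (L := L) a b))
  let e := (Finite.equivFin ι).symm
  refine ⟨Nat.card ι, Nat.one_le_iff_ne_zero.2 Nat.card_pos.ne', fun i => (α (e i)).Quo,
    fun i => inferInstance, fun i => ⟨hM.of_surjective _ (α (e i)).quoHom_surjective, ?_⟩, ?_⟩
  · refine (existsUnique_isCoatom_iff (α (e i)).quoHom_surjective).2 ?_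
    rw [ker_quoHom]
    exact h.existsUnique_coatom (e i)
  · refine nonempty_equiv_pi_quo hA (α := fun i => α (e i)) ?_ fun i j hij =>
      h.sup_eq_top _ _ (e.injective.ne hij)
    rw [← h.iInf_eq_bot]
    exact e.iInf_comp (g := α)

/-! ### From a product of local algebras back to the algebra. -/

section Product

variable {ι : Type*} {B : ι → Type u} [∀ i, L.Structure (B i)] [L.IsAlgebraic]

/-- The `k`-th coordinate of an isomorphism onto a product. -/
def coordHom (f : L.Equiv A (∀ i, B i)) (k : ι) : A →[L] B k where
  toFun a := f a k
  map_fun' F x := congrFun (f.map_fun F x) k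
  map_rel' r := isEmptyElim r

theorem coordHom_surjective [∀ i, Nonempty (B i)] (f : L.Equiv A (∀ i, B i)) (k : ι) :
    Function.Surjective (coordHom f k) := by
  classical
  intro b
  obtain ⟨a, ha⟩ := f.surjective (Function.update (fun i => Classical.arbitrary (B i)) k b)
  exact ⟨a, (congrFun ha k).trans (Function.update_self ..)⟩

theorem iInf_ker_coordHom (f : L.Equiv A (∀ i, B i)) : ⨅ k, ker (coordHom f k) = ⊥ :=
  rel_ext fun a b => by
    rw [rel_iInf]
    exact ⟨fun h => f.injective (funext h), fun h k => congrArg (fun a => f a k) h⟩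

theorem isCompl_ker_coordHom (f : L.Equiv A (∀ i, B i)) (k : ι) :
    IsCompl (ker (coordHom f k)) (⨅ j : {j // j ≠ k}, ker (coordHom f j)) := by
  classical
  refine IsCompl.of_eq ?_ (eq_top_iff_rel.2 fun a b => ?_)
  · rw [← iInf_ker_coordHom f]
    refine le_antisymm (le_iInf fun j => ?_) (le_inf (iInf_le _ _) (le_iInf fun j => iInf_le _ _))
    by_cases hj : j = k
    · exact hj ▸ inf_le_left
    · exact inf_le_right.trans (iInf_le (fun j : {j // j ≠ k} => ker (coordHom f j)) ⟨j, hj⟩)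
  -- The element with `k`-th coordinate from `a` and all others from `b` connects `a` to `b`.
  · obtain ⟨c, hc⟩ := f.surjective (Function.update (f b) k (f a k))
    have h1 : (ker (coordHom f k)).Rel a c :=
      ((congrFun hc k).trans (Function.update_self ..)).symm
    have h2 : (⨅ j : {j // j ≠ k}, ker (coordHom f j)).Rel c b :=
      rel_iInf.2 fun j => (congrFun hc j).trans (Function.update_of_ne j.2 ..)
    exact Rel.trans (le_sup_left (b := ⨅ j : {j // j ≠ k}, ker (coordHom f j)) _ _ h1)
      (le_sup_right (a := ker (coordHom f k)) _ _ h2)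

theorem isLocalDecomposition_ker_coordHom [∀ i, Nonempty (B i)]
    (hloc : ∀ i, IsLocalAlgebra L (B i)) (f : L.Equiv A (∀ i, B i)) :
    IsLocalDecomposition fun k => ker (coordHom f k) where
  isComplemented k := ⟨_, isCompl_ker_coordHom f k⟩
  iInf_eq_bot := iInf_ker_coordHom f
  sup_eq_top i j hij := by
    rw [← top_le_iff, ← (isCompl_ker_coordHom f i).sup_eq_top]
    exact sup_le_sup_left
      (iInf_le (fun j : {j // j ≠ i} => ker (coordHom f j)) ⟨j, hij.symm⟩) _
  existsUnique_coatom k := (existsUnique_isCoatom_iff (coordHom_surjective f k)).1 (hloc k)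

/-- The system is solved in each factor modulo the image of `ker (coordHom f k) ⊔ θ i`. The
coordinates glue to a solution because, by distributivity and finiteness of `ι`, `θ i` is the meet
of these joins. -/
theorem IsMaximalAlgebra.of_equiv_pi [∀ i, Nonempty (B i)] [Finite ι]
    (hA : IsCongruenceDistributive L A) (hM : ∀ i, IsMaximalAlgebra L (B i))
    (f : L.Equiv A (∀ i, B i)) : IsMaximalAlgebra L A := by
  intro I a θ hJ
  have hex : ∀ (k : ι) (i : I), ∃ φ, comap (coordHom f k) φ = ker (coordHom f k) ⊔ θ i :=
    fun k i => exists_comap_eq _ (coordHom_surjective f k) le_sup_left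
  choose φ hφ using hex
  have hsol : ∀ k, ∃ y : B k, ∀ i, (φ k i).Rel y (coordHom f k (a i)) := fun k =>
    hM k I (fun i => coordHom f k (a i)) (φ k) fun J => by
      obtain ⟨x, hx⟩ := hJ J
      refine ⟨coordHom f k x, fun i hi => ?_⟩
      rw [← rel_comap, hφ]
      exact le_sup_right (a := ker (coordHom f k)) _ _ (hx i hi)
  choose y hy using hsol
  obtain ⟨x, hx⟩ := f.surjective y
  refine ⟨x, fun i => ?_⟩
  let := frameOfDistributive hA
  have hθ : θ i = ⨅ k, ker (coordHom f k) ⊔ θ i := by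
    rw [← Finite.iInf_sup_eq_of_frame, iInf_ker_coordHom, bot_sup_eq]
  rw [hθ, rel_iInf]
  intro k
  rw [← hφ, rel_comap]
  have : coordHom f k x = y k := congrFun hx k
  rw [this]
  exact hy k i

end Product

theorem IsLocalAlgebra.nonempty (h : IsLocalAlgebra L A) : Nonempty A := by
  obtain ⟨μ, hμ, -⟩ := h
  by_contra hn
  exact hμ.1 (eq_top_iff_rel.2 fun a => (hn ⟨a⟩).elim)

theorem IsLocalDecomposition.hasStar (hA : IsCongruenceDistributive L A) (hH : HypothesisH L A)
    {ι : Type*} [Finite ι] {π : ι → Congruence L A} (h : IsLocalDecomposition π) :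
    HasStar L A := by
  intro θ hθ
  have := hH.isCoatomic
  let := frameOfDistributive hA
  obtain ⟨b, c, hbc, hle, hRad⟩ := h.exists_star θ
  refine ⟨θ ⊓ c, b, isFinGen_iff_isCompactElement.2
    (hθ.isCompactElement.inf_of_isCompl hbc), ⟨c, hbc⟩, hRad, ?_⟩
  rw [sup_inf_right, sup_comm c b, hbc.sup_eq_top, inf_top_eq, sup_eq_left.2 hle]

theorem IsLocalDecomposition.algebraHasCBLP [L.IsAlgebraic] (hA : IsCongruenceDistributive L A)
    (hH : HypothesisH L A) {ι : Type*} [Finite ι] {π : ι → Congruence L A}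
    (h : IsLocalDecomposition π) : AlgebraHasCBLP L A := by
  have := hH.isCoatomic
  let := frameOfDistributive hA
  exact fun θ => (hasCBLP_iff θ).2 fun γ δ hinf hsup => h.exists_isComplemented_sup_eq hinf hsup

end UnivAlg

theorem mainTheorem11 (L : FirstOrder.Language.{v, w}) [L.IsAlgebraic] (A : Type u)
    [L.Structure A] [Nontrivial A] (hA : UnivAlg.IsArithmetical L A)
    (hH : UnivAlg.HypothesisH L A) :
    List.TFAE [
      UnivAlg.IsMaximalAlgebra L A ∧ UnivAlg.HasStar L A,
      UnivAlg.IsMaximalAlgebra L A ∧ UnivAlg.AlgebraHasCBLP L A,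
      UnivAlg.IsMaximalAlgebra L A ∧ (UnivAlg.Rad L A).HasCBLP,
      ∃ (n : ℕ) (_ : 1 ≤ n) (B : Fin n → Type u) (_ : ∀ i, L.Structure (B i)),
        (∀ i, UnivAlg.IsMaximalAlgebra L (B i) ∧ UnivAlg.IsLocalAlgebra L (B i)) ∧
          Nonempty (L.Equiv A (∀ i, B i))] := by
  tfae_have 2 → 3 := fun h => ⟨h.1, h.2 _⟩
  tfae_have 3 → 4 := by
    rintro ⟨hM, h⟩
    have := hM.finite_coatoms hA hH
    obtain ⟨α, hα⟩ := UnivAlg.exists_isLocalDecomposition_of_hasCBLP hM hA hH h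
    exact UnivAlg.IsLocalDecomposition.exists_equiv_pi hM hA hα
  tfae_have 1 → 4 := by
    rintro ⟨hM, h⟩
    have := hM.finite_coatoms hA hH
    obtain ⟨α, hα⟩ := UnivAlg.exists_isLocalDecomposition_of_hasStar hM hA hH h
    exact UnivAlg.IsLocalDecomposition.exists_equiv_pi hM hA hα
  tfae_have 4 → 1 := by
    rintro ⟨n, -, B, _, hB, ⟨f⟩⟩
    have := fun i => (hB i).2.nonempty
    exact ⟨.of_equiv_pi hA.1 (fun i => (hB i).1) f, UnivAlg.IsLocalDecomposition.hasStar hA.1 hH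
      (UnivAlg.isLocalDecomposition_ker_coordHom (fun i => (hB i).2) f)⟩
  tfae_have 4 → 2 := by
    rintro ⟨n, -, B, _, hB, ⟨f⟩⟩
    have := fun i => (hB i).2.nonempty
    exact ⟨.of_equiv_pi hA.1 (fun i => (hB i).1) f,
      UnivAlg.IsLocalDecomposition.algebraHasCBLP hA.1 hH
        (UnivAlg.isLocalDecomposition_ker_coordHom (fun i => (hB i).2) f)⟩
  tfae_finish
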